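/- Let $\mathcal H$ be a separable real or complex Hilbert space with a fixed orthonormal basis $(b_i)_{i\in I}$, and write $x_{ij}=\langle b_i, x b_j\rangle$ for the matrix entries of $x\in B(\mathcal H)$. An operator is called diagonal if $x_{ij}=0$ whenever $i\ne j$; let $D(\mathcal H)$ be the algebra of diagonal operators and $E\colon B(\mathcal H)\to D(\mathcal H)$ the map that erases the off-diagonal entries. Equip $B(\mathcal H)$ with the $w^*$-topology that it carries as the dual of the space $S_1$ of trace-class operators, under the pairing $(t,c)\mapsto \operatorname{Tr}(tc)$. Let $p\in B(\mathcal H)$ be an orthogonal projection. Let $\sim$ be the smallest equivalence relation on $I$ such that $i\sim j$ whenever $p_{ij}\neq 0$, let $J$ be the set of its equivalence classes, and for $j\in J$ let $f_j$ be the orthogonal projection onto the closed linear span of $\{b_i : i\in j\}$ (so that $p=\sum_{j\in J}pf_j$ is the minimal block decomposition of $p$). **Theorem.** The $w^*$-closure of the set $$\{E(q) : q\in B(\mathcal H),\ q^2=q,\ \operatorname{Ran} q=\operatorname{Ran} p\}$$ is exactly the set of all $d\in D(\mathcal H)$ such that $\operatorname{Tr}(df_j)=\operatorname{rank}(pf_j)$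 for every $j\in J$ for which $f_j$ has finite rank. -/

import Mathlib

open scoped InnerProductSpace Topology

noncomputable section

namespace DiagIdem

variable {𝕜 : Type*} [RCLike 𝕜] {H : Type*} [NormedAddCommGroup H] [InnerProductSpace 𝕜 H]
  {ι : Type*}

/-- The matrix entry `x_{ij} = ⟨b_i, x b_j⟩` of a bounded operator in the orthonormal basis `b`. -/
def entry (b : HilbertBasis ι 𝕜 H) (x : H →L[𝕜] H) (i j : ι) : 𝕜 := ⟪b i, x (b j)⟫_𝕜

/-- `x` is diagonal: all of its off-diagonal entries vanish. -/
def IsDiagonal (b : HilbertBasis ι 𝕜 H) (x : H →L[𝕜] H) : Prop :=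
  ∀ i j, i ≠ j → entry b x i j = 0

theorem norm_entry_le (b : HilbertBasis ι 𝕜 H) (x : H →L[𝕜] H) (i j : ι) :
    ‖entry b x i j‖ ≤ ‖x‖ := by
  have h1 : ∀ k, ‖b k‖ = 1 := b.orthonormal.1
  calc ‖entry b x i j‖ ≤ ‖b i‖ * ‖x (b j)‖ := norm_inner_le_norm _ _
    _ ≤ ‖x‖ := by rw [h1, one_mul]; simpa [h1] using x.le_opNorm (b j)

theorem norm_entry_mul_le (b : HilbertBasis ι 𝕜 H) (x : H →L[𝕜] H) (g : lp (fun _ : ι => 𝕜) 2)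
    (i : ι) : ‖entry b x i i * g i‖ ≤ ‖(((‖x‖ : ℝ) : 𝕜) • g) i‖ := by
  rw [norm_mul, lp.coeFn_smul, Pi.smul_apply, norm_smul, RCLike.norm_ofReal, abs_norm]
  exact mul_le_mul_of_nonneg_right (norm_entry_le b x i i) (norm_nonneg _)

theorem memlp_entry_mul (b : HilbertBasis ι 𝕜 H) (x : H →L[𝕜] H) (g : lp (fun _ : ι => 𝕜) 2) :
    Memℓp (fun i => entry b x i i * g i) 2 := by
  have h := lp.memℓp (((‖x‖ : ℝ) : 𝕜) • g)
  have h2 : (0 : ℝ) < (2 : ENNReal).toReal := by norm_num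
  refine memℓp_gen ((h.summable h2).of_nonneg_of_le (fun i => by positivity) fun i => ?_)
  exact Real.rpow_le_rpow (norm_nonneg _) (norm_entry_mul_le b x g i) h2.le

/-- Multiplication by the diagonal entries of `x` on square summable sequences. -/
def mulDiag (b : HilbertBasis ι 𝕜 H) (x : H →L[𝕜] H) :
    lp (fun _ : ι => 𝕜) 2 →L[𝕜] lp (fun _ : ι => 𝕜) 2 :=
  LinearMap.mkContinuous
    { toFun := fun g => ⟨fun i => entry b x i i * g i, memlp_entry_mul b x g⟩
      map_add' := fun g h => by ext i; exact mul_add _ _ _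
      map_smul' := fun a g => by ext i; simp [mul_left_comm] }
    ‖x‖ (fun g => by
      have h2 : (2 : ENNReal) ≠ 0 := by norm_num
      refine (lp.norm_mono h2 (norm_entry_mul_le b x g)).trans ?_
      rw [norm_smul, RCLike.norm_ofReal, abs_norm])

/-- The diagonal conditional expectation `E`: it keeps the diagonal entries of `x` and erases the
others, that is `E(x) v = ∑ i, x_{ii} ⟨b_i, v⟩ b_i`. -/
def diagExp (b : HilbertBasis ι 𝕜 H) (x : H →L[𝕜] H) : H →L[𝕜] H :=
  (b.repr.symm.toContinuousLinearEquiv : lp (fun _ : ι => 𝕜) 2 →L[𝕜] H) ∘L mulDiag b x ∘L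
    (b.repr.toContinuousLinearEquiv : H →L[𝕜] lp (fun _ : ι => 𝕜) 2)

theorem inner_diagExp (b : HilbertBasis ι 𝕜 H) (x : H →L[𝕜] H) (i : ι) (v : H) :
    ⟪b i, diagExp b x v⟫_𝕜 = entry b x i i * ⟪b i, v⟫_𝕜 := by
  rw [← b.repr_apply_apply, ← b.repr_apply_apply]
  simp [diagExp, mulDiag]

theorem entry_diagExp [DecidableEq ι] (b : HilbertBasis ι 𝕜 H) (x : H →L[𝕜] H) (i j : ι) :
    entry b (diagExp b x) i j = if i = j then entry b x i j else 0 := by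
  rw [entry, inner_diagExp, orthonormal_iff_ite.1 b.orthonormal]
  split_ifs with h <;> simp [h]

/-- The smallest equivalence relation on the index set of the basis for which `i` and `j` are
equivalent whenever the entry `x_{ij}` is nonzero. -/
def blockSetoid (b : HilbertBasis ι 𝕜 H) (x : H →L[𝕜] H) : Setoid ι :=
  Relation.EqvGen.setoid fun i j => entry b x i j ≠ 0

/-- The index set `J` of the minimal block decomposition `x = ∑_{j ∈ J} x f_j`: the set of
equivalence classes. -/
abbrev BlockIndex (b : HilbertBasis ι 𝕜 H) (x : H →L[𝕜] H) : Type _ :=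
  Quotient (blockSetoid b x)

/-- The projection `f_j` of the minimal block decomposition of `x`: the sum of the rank one
projections onto the lines `𝕜 b_i`, with `i` in the class `j`, i.e. the orthogonal projection onto
the closed span of these `b_i`. -/
def blockProj [CompleteSpace H] (b : HilbertBasis ι 𝕜 H) (x : H →L[𝕜] H) (j : BlockIndex b x) :
    H →L[𝕜] H :=
  (Submodule.span 𝕜 (b '' {i | Quotient.mk (blockSetoid b x) i = j})).topologicalClosure.starProjection

/-- Trace class (nuclear) operators on a Hilbert space: `c = ∑ n, ⟨y_n, ·⟩ x_n` with
`∑ n, ‖x_n‖ ‖y_n‖ < ∞`. -/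
def IsTraceClass (c : H →L[𝕜] H) : Prop :=
  ∃ x y : ℕ → H, Summable (fun n => ‖x n‖ * ‖y n‖) ∧
    ∀ v, HasSum (fun n => ⟪y n, v⟫_𝕜 • x n) (c v)

/-- The trace `∑ i, t_{ii}`; it is used for trace class `t` only, where the sum converges
absolutely and does not depend on the basis. -/
def trace (b : HilbertBasis ι 𝕜 H) (t : H →L[𝕜] H) : 𝕜 := ∑' i, entry b t i i

/-- The `w*`-topology on `B(H)`, regarded as the dual of the trace class through the pairing
`(t, c) ↦ Tr(t c)`: the coarsest topology for which `t ↦ Tr(t c)` is continuous for every trace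
class `c`. -/
abbrev weakStarTopology (b : HilbertBasis ι 𝕜 H) : TopologicalSpace (H →L[𝕜] H) :=
  ⨅ c : {c : H →L[𝕜] H // IsTraceClass c},
    TopologicalSpace.induced (fun t => trace b (t ∘L c.1)) inferInstance

end DiagIdem

end

/-! The idempotents with range Ran p are exactly the operators p + p x (1 - p), so their diagonals
form an affine space through E(p), and its closure is a matter of duality. A trace class operator
tests a diagonal operator only through its own diagonal, a summable sequence a. Suppose a
annihilates every p x (1 - p). Taking x to be the projection onto the line of b_i gives p_ii a_i =
∑_k |p_ki|² a_k: a is harmonic for symmetric weights with row sums p_ii ≤ 1. Its Dirichlet energy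
then vanishes (`eq_of_harmonic`), so a is constant on each block, and zero on infinite blocks by
summability. Hence the block traces over finite blocks are the only obstructions
(`diagPairing_eq_zero_of_annihilator`). Conversely, every E(q) has these block traces because p (q
(1 - p)) contributes trace zero over a finite block, and the conditions are w*-closed, being given
by finite rank test operators. -/

namespace DiagIdem

variable {𝕜 : Type*} [RCLike 𝕜] {H : Type*} [NormedAddCommGroup H] [InnerProductSpace 𝕜 H]
  {ι : Type*}

/-! ### Harmonic sequences for symmetric weights -/

/-- A summable function which is harmonic for symmetric summable weights is constant along
nonzero weights. -/
theorem eq_of_harmonic {w : ι → ι → ℝ} {s : ι → ℝ} {a : ι → 𝕜} (hw : ∀ i k, 0 ≤ w i k)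
    (hsymm : ∀ i k, w i k = w k i) (hs : ∀ i, HasSum (w i) (s i)) (hs1 : ∀ i, s i ≤ 1)
    (ha : Summable fun i => ‖a i‖)
    (harm : ∀ i, HasSum (fun k => (w i k : 𝕜) * a k) ((s i : 𝕜) * a i)) (i k : ι)
    (hik : w i k ≠ 0) : a i = a k := by
  have hA : Summable fun i => ‖a i‖ ^ 2 := by
    refine (ha.mul_left (∑' i, ‖a i‖)).of_nonneg_of_le (fun i => sq_nonneg _) fun i => ?_
    rw [pow_two]
    exact mul_le_mul_of_nonneg_right (ha.le_tsum i fun _ _ => norm_nonneg _) (norm_nonneg _)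
  set g : ι × ι → ℝ := fun x => w x.1 x.2 * ‖a x.1‖ ^ 2 with hg
  have hgi : ∀ i, HasSum (fun k => g (i, k)) (s i * ‖a i‖ ^ 2) := fun i =>
    (hs i).mul_right _
  have hs0 : ∀ i, 0 ≤ s i := fun i => (hs i).nonneg (hw i)
  have hgs : Summable g := by
    rw [summable_prod_of_nonneg fun x => mul_nonneg (hw _ _) (sq_nonneg _)]
    refine ⟨fun i => (hgi i).summable, ?_⟩
    exact hA.of_nonneg_of_le (fun i => tsum_nonneg fun k => mul_nonneg (hw _ _) (sq_nonneg _))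
      fun i => (hgi i).tsum_eq.trans_le (mul_le_of_le_one_left (sq_nonneg _) (hs1 i))
  set h : ι × ι → ℝ := fun x => w x.1 x.2 * ‖a x.2‖ ^ 2 with hh
  have hhg : h = g ∘ Prod.swap := by
    ext ⟨i, k⟩
    simp [hh, hg, hsymm i k]
  have hhs : Summable h := hhg ▸ (Equiv.prodComm ι ι).summable_iff.2 hgs
  have hgh : ∑' x, h x = ∑' x, g x := by
    rw [hhg]
    exact (Equiv.prodComm ι ι).tsum_eq g
  -- The Dirichlet energy density; once its total is zero, every term vanishes.
  set D : ι × ι → ℝ := fun x => w x.1 x.2 * ‖a x.1 - a x.2‖ ^ 2 with hD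
  have hD0 : ∀ x, 0 ≤ D x := fun x => mul_nonneg (hw _ _) (sq_nonneg _)
  have hDs : Summable D := by
    refine ((hgs.add hhs).mul_left 2).of_nonneg_of_le hD0 fun x => ?_
    have h1 : ‖a x.1 - a x.2‖ ^ 2 ≤ 2 * (‖a x.1‖ ^ 2 + ‖a x.2‖ ^ 2) := by
      have := norm_sub_le (a x.1) (a x.2)
      nlinarith [norm_nonneg (a x.1 - a x.2), sq_nonneg (‖a x.1‖ - ‖a x.2‖)]
    calc D x ≤ w x.1 x.2 * (2 * (‖a x.1‖ ^ 2 + ‖a x.2‖ ^ 2)) :=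
          mul_le_mul_of_nonneg_left h1 (hw _ _)
      _ = 2 * (g x + h x) := by simp only [hg, hh]; ring
  -- In the expansion of the square, harmonicity evaluates the cross term as -2 s_i ‖a_i‖².
  have hDi : ∀ i, HasSum (fun k => D (i, k)) (∑' k, h (i, k) - s i * ‖a i‖ ^ 2) := fun i => by
    have h1 : HasSum (fun k => RCLike.re (starRingEnd 𝕜 (a i) * ((w i k : 𝕜) * a k)))
        (s i * ‖a i‖ ^ 2) := by
      have h2 : s i * ‖a i‖ ^ 2 =
          RCLike.re (starRingEnd 𝕜 (a i) * ((s i : 𝕜) * a i)) := by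
        rw [mul_left_comm, RCLike.conj_mul, ← RCLike.ofReal_pow, ← RCLike.ofReal_mul,
          RCLike.ofReal_re]
      rw [h2]
      exact ((harm i).mul_left (starRingEnd 𝕜 (a i))).mapL RCLike.reCLM
    have h3 := ((hgi i).add (hhs.prod_factor i).hasSum).sub (h1.mul_left 2)
    rw [show ∑' k, h (i, k) - s i * ‖a i‖ ^ 2 =
      s i * ‖a i‖ ^ 2 + ∑' k, h (i, k) - 2 * (s i * ‖a i‖ ^ 2) by ring]
    refine (show (fun k => D (i, k)) = _ from ?_) ▸ h3
    funext k
    have h2 := norm_sub_sq (𝕜 := 𝕜) (a i) (a k)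
    rw [RCLike.inner_apply'] at h2
    simp only [hD, hg, hh]
    rw [h2, mul_left_comm (starRingEnd 𝕜 (a i)), RCLike.re_ofReal_mul]
    ring
  -- Row sums of D are those of h minus those of g, and h and g have equal totals by symmetry of the
  -- weights.
  have hD_zero : ∑' x, D x = 0 := by
    have h1 : ∀ i, ∑' k, D (i, k) = ∑' k, h (i, k) - ∑' k, g (i, k) := fun i => by
      rw [(hDi i).tsum_eq, (hgi i).tsum_eq]
    rw [hDs.tsum_prod, tsum_congr h1, hhs.prod.tsum_sub hgs.prod, ← hhs.tsum_prod, hgh,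
      hgs.tsum_prod, sub_self]
  have hz := (hasSum_zero_iff_of_nonneg hD0).1 (hD_zero ▸ hDs.hasSum)
  have h0 : w i k * ‖a i - a k‖ ^ 2 = 0 := congrFun hz (i, k)
  simpa [hik, sub_eq_zero] using h0

/-! ### Diagonals and trace class operators -/

theorem sum_norm_inner_mul_le (b : HilbertBasis ι 𝕜 H) (x y : H) (s : Finset ι) :
    ∑ i ∈ s, ‖⟪y, b i⟫_𝕜‖ * ‖⟪b i, x⟫_𝕜‖ ≤ ‖x‖ * ‖y‖ := by
  have h := Real.sum_mul_le_sqrt_mul_sqrt s (fun i => ‖⟪y, b i⟫_𝕜‖) (fun i => ‖⟪b i, x⟫_𝕜‖)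
  have h1 : ∑ i ∈ s, ‖⟪y, b i⟫_𝕜‖ ^ 2 ≤ ‖y‖ ^ 2 := by
    simpa only [norm_inner_symm] using b.orthonormal.sum_inner_products_le (s := s) y
  have h2 : ∑ i ∈ s, ‖⟪b i, x⟫_𝕜‖ ^ 2 ≤ ‖x‖ ^ 2 := b.orthonormal.sum_inner_products_le x
  calc _ ≤ _ := h
    _ ≤ ‖y‖ * ‖x‖ := by
        gcongr
        · exact Real.sqrt_le_iff.2 ⟨norm_nonneg _, h1⟩
        · exact Real.sqrt_le_iff.2 ⟨norm_nonneg _, h2⟩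
    _ = _ := mul_comm _ _

/-- Cauchy–Schwarz and Bessel bound each nuclear term over any finite set of indices, so all partial
sums stay below ∑ ‖x_n‖ ‖y_n‖. -/
theorem IsTraceClass.summable_norm_entry (b : HilbertBasis ι 𝕜 H) {c : H →L[𝕜] H}
    (hc : IsTraceClass c) : Summable fun i => ‖entry b c i i‖ := by
  obtain ⟨x, y, hxy, hc⟩ := hc
  have hF : ∀ i, Summable fun n => ‖⟪y n, b i⟫_𝕜‖ * ‖⟪b i, x n⟫_𝕜‖ := fun i =>
    hxy.of_nonneg_of_le (fun n => by positivity) fun n => by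
      simpa using sum_norm_inner_mul_le b (x n) (y n) {i}
  refine summable_of_sum_le (c := ∑' n, ‖x n‖ * ‖y n‖) (fun i => norm_nonneg _) fun s => ?_
  have hle : ∀ i, ‖entry b c i i‖ ≤ ∑' n, ‖⟪y n, b i⟫_𝕜‖ * ‖⟪b i, x n⟫_𝕜‖ := fun i => by
    have h := (hc (b i)).mapL (innerSL 𝕜 (b i))
    simp only [innerSL_apply_apply, inner_smul_right] at h
    rw [entry, ← h.tsum_eq]
    simpa only [norm_mul] using norm_tsum_le_tsum_norm
      (f := fun n => ⟪y n, b i⟫_𝕜 * ⟪b i, x n⟫_𝕜) (by simpa only [norm_mul] using hF i)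
  calc _ ≤ ∑ i ∈ s, ∑' n, ‖⟪y n, b i⟫_𝕜‖ * ‖⟪b i, x n⟫_𝕜‖ := Finset.sum_le_sum fun i _ => hle i
    _ = ∑' n, ∑ i ∈ s, ‖⟪y n, b i⟫_𝕜‖ * ‖⟪b i, x n⟫_𝕜‖ :=
        (Summable.tsum_finsetSum fun i _ => hF i).symm
    _ ≤ _ := (summable_sum fun i _ => hF i).tsum_le_tsum
        (fun n => sum_norm_inner_mul_le b (x n) (y n) s) hxy

theorem entry_diagExp_comp (b : HilbertBasis ι 𝕜 H) (x c : H →L[𝕜] H) (i : ι) :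
    entry b (diagExp b x ∘L c) i i = entry b x i i * entry b c i i :=
  inner_diagExp b x i _

theorem hilbertBasis_ext_inner (b : HilbertBasis ι 𝕜 H) {u v : H}
    (h : ∀ i, ⟪b i, u⟫_𝕜 = ⟪b i, v⟫_𝕜) : u = v := by
  apply b.repr.injective
  ext i
  simpa only [b.repr_apply_apply] using h i

theorem IsDiagonal.diagExp_eq {b : HilbertBasis ι 𝕜 H} {d : H →L[𝕜] H} (hd : IsDiagonal b d) :
    diagExp b d = d := by
  classical
  refine ContinuousLinearMap.ext_on (Submodule.dense_iff_topologicalClosure_eq_top.2 b.dense_span) ?_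
  rintro _ ⟨j, rfl⟩
  refine hilbertBasis_ext_inner b fun i => ?_
  have := entry_diagExp b d i j
  change entry b (diagExp b d) i j = entry b d i j
  rw [this]
  split_ifs with h
  · rfl
  · exact (hd i j h).symm

theorem isDiagonal_diagExp (b : HilbertBasis ι 𝕜 H) (x : H →L[𝕜] H) :
    IsDiagonal b (diagExp b x) := fun i j h => by
  classical rw [entry_diagExp, if_neg h]

theorem isTraceClass_of_finset {α : Type*} (s : Finset α) (x y : α → H) {c : H →L[𝕜] H}
    (hc : ∀ v, c v = ∑ i ∈ s, ⟪y i, v⟫_𝕜 • x i) : IsTraceClass c := by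
  classical
  let e := s.equivFin
  let ext (z : α → H) (n : ℕ) : H := if h : n < s.card then z (e.symm ⟨n, h⟩) else 0
  refine ⟨ext x, ext y, ?_, fun v => ?_⟩
  · exact summable_of_ne_finset_zero (s := Finset.range s.card) fun n hn => by
      simp_all [ext]
  · have : c v = ∑ n ∈ Finset.range s.card, ⟪ext y n, v⟫_𝕜 • ext x n := by
      rw [hc, Finset.sum_range, ← Finset.sum_coe_sort, ← e.symm.sum_comp]
      exact Finset.sum_congr rfl fun n _ => by simp [ext]
    rw [this]
    exact hasSum_sum_of_ne_finset_zero fun n hn => by simp_all [ext]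

theorem isTraceClass_rankOne (x y : H) :
    IsTraceClass (InnerProductSpace.rankOne 𝕜 x y : H →L[𝕜] H) :=
  isTraceClass_of_finset {()} (fun _ => x) (fun _ => y) fun v => by simp

/-! ### Blocks and their projections -/

/-- The class of indices belonging to a block. -/
def blockSet (b : HilbertBasis ι 𝕜 H) (x : H →L[𝕜] H) (j : BlockIndex b x) : Set ι :=
  {i | Quotient.mk (blockSetoid b x) i = j}

theorem entry_eq_zero_of_mem_blockSet {b : HilbertBasis ι 𝕜 H} {x : H →L[𝕜] H}
    {j : BlockIndex b x} {i k : ι} (hi : i ∈ blockSet b x j) (hk : k ∉ blockSet b x j) :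
    entry b x k i = 0 := by
  by_contra h
  exact hk ((Quotient.sound (s := blockSetoid b x) (Relation.EqvGen.rel _ _ h)).trans hi)

section
variable [CompleteSpace H] (b : HilbertBasis ι 𝕜 H) (x : H →L[𝕜] H) (j : BlockIndex b x)

theorem blockProj_basis_of_mem {i : ι} (hi : i ∈ blockSet b x j) :
    blockProj b x j (b i) = b i :=
  Submodule.starProjection_eq_self_iff.2
    (Submodule.le_topologicalClosure _ (Submodule.subset_span ⟨i, hi, rfl⟩))

theorem blockProj_basis_of_notMem {i : ι} (hi : i ∉ blockSet b x j) :
    blockProj b x j (b i) = 0 := by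
  refine (Submodule.starProjection_apply_eq_zero_iff _).2 ?_
  rw [Submodule.orthogonal_closure, Submodule.mem_orthogonal]
  intro u hu
  induction hu using Submodule.span_induction with
  | mem u hu =>
    obtain ⟨k, hk, rfl⟩ := hu
    exact b.orthonormal.inner_eq_zero fun h => hi (h ▸ hk)
  | zero => simp
  | add u v _ _ hu hv => rw [inner_add_left, hu, hv, add_zero]
  | smul a u _ hu => rw [inner_smul_left, hu, mul_zero]

theorem inner_blockProj (u v : H) : ⟪u, blockProj b x j v⟫_𝕜 = ⟪blockProj b x j u, v⟫_𝕜 :=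
  (Submodule.inner_starProjection_left_eq_right _ u v).symm

theorem finite_blockSet [FiniteDimensional 𝕜 (blockProj b x j).range] :
    (blockSet b x j).Finite := by
  let f : blockSet b x j → (blockProj b x j).range := fun i =>
    ⟨b i, b i, blockProj_basis_of_mem b x j i.2⟩
  have hf : LinearIndependent 𝕜 f := by
    refine LinearIndependent.of_comp (blockProj b x j).range.subtype ?_
    exact b.orthonormal.linearIndependent.comp _ Subtype.val_injective
  have := hf.finite
  exact Set.toFinite _

theorem finiteDimensional_range_blockProj (h : (blockSet b x j).Finite) :
    FiniteDimensional 𝕜 (blockProj b x j).range := by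
  have : FiniteDimensional 𝕜 (Submodule.span 𝕜 (b '' blockSet b x j)) :=
    FiniteDimensional.span_of_finite 𝕜 (h.image _)
  have h2 : (blockProj b x j).range = Submodule.span 𝕜 (b '' blockSet b x j) := by
    rw [← (Submodule.closed_of_finiteDimensional
      (Submodule.span 𝕜 (b '' blockSet b x j))).submodule_topologicalClosure_eq]
    exact Submodule.range_starProjection _
  rwa [h2]

theorem blockProj_apply_eq_sum (h : (blockSet b x j).Finite) (v : H) :
    blockProj b x j v = ∑ i ∈ h.toFinset, ⟪b i, v⟫_𝕜 • b i := by
  classical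
  refine hilbertBasis_ext_inner b fun k => ?_
  rw [inner_blockProj]
  by_cases hk : k ∈ blockSet b x j
  · rw [blockProj_basis_of_mem b x j hk]
    simp [inner_sum, inner_smul_right, orthonormal_iff_ite.1 b.orthonormal, hk]
  · rw [blockProj_basis_of_notMem b x j hk]
    simp [inner_sum, inner_smul_right, orthonormal_iff_ite.1 b.orthonormal, hk]

theorem isTraceClass_blockProj (h : (blockSet b x j).Finite) :
    IsTraceClass (blockProj b x j) :=
  isTraceClass_of_finset _ _ _ (blockProj_apply_eq_sum b x j h)

theorem trace_comp_blockProj (h : (blockSet b x j).Finite) (d : H →L[𝕜] H) :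
    trace b (d ∘L blockProj b x j) = ∑ i ∈ h.toFinset, entry b d i i := by
  rw [trace, tsum_eq_sum (s := h.toFinset)]
  · refine Finset.sum_congr rfl fun i hi => ?_
    rw [entry, ContinuousLinearMap.comp_apply,
      blockProj_basis_of_mem b x j (h.mem_toFinset.1 hi), entry]
  · intro i hi
    rw [entry, ContinuousLinearMap.comp_apply,
      blockProj_basis_of_notMem b x j (fun h' => hi (h.mem_toFinset.2 h')), map_zero,
      inner_zero_right]

end

theorem apply_basis_eq_sum (b : HilbertBasis ι 𝕜 H) (p : H →L[𝕜] H) (j : BlockIndex b p) (h : (blockSet b p j).Finite) {i : ι}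
    (hi : i ∈ blockSet b p j) : p (b i) = ∑ k ∈ h.toFinset, entry b p k i • b k := by
  classical
  refine hilbertBasis_ext_inner b fun k => ?_
  by_cases hk : k ∈ blockSet b p j
  · simp [inner_sum, inner_smul_right, orthonormal_iff_ite.1 b.orthonormal, hk, entry]
  · have := entry_eq_zero_of_mem_blockSet hi hk
    simpa [inner_sum, inner_smul_right, orthonormal_iff_ite.1 b.orthonormal, hk, entry] using this

/-! ### Block traces of idempotents with the range of p -/

section Projection
variable [CompleteSpace H] (b : HilbertBasis ι 𝕜 H) {p : H →L[𝕜] H} (hp : IsStarProjection p)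
include hp

theorem inner_projection_left (u v : H) : ⟪p u, v⟫_𝕜 = ⟪u, p v⟫_𝕜 :=
  hp.isSelfAdjoint.isSymmetric u v

theorem projection_projection (v : H) : p (p v) = p v :=
  congr($(hp.isIdempotentElem) v)

theorem entry_projection_swap (i k : ι) :
    entry b p i k = starRingEnd 𝕜 (entry b p k i) := by
  rw [entry, entry, inner_conj_symm, inner_projection_left hp]

/-- An orthonormal basis of the range of p f_j is supported on the block, so by Parseval each of its
vectors contributes 1 to the trace. -/
theorem sum_entry_eq_finrank (j : BlockIndex b p) (h : (blockSet b p j).Finite) :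
    ∑ i ∈ h.toFinset, entry b p i i = (Module.finrank 𝕜 (p ∘L blockProj b p j).range : 𝕜) := by
  have hfd := finiteDimensional_range_blockProj b p j h
  set R := (p ∘L blockProj b p j).range with hR
  have hRmap : R = (blockProj b p j).range.map (p : H →ₗ[𝕜] H) := LinearMap.range_comp _ _
  have : FiniteDimensional 𝕜 R := by rw [hRmap]; infer_instance
  let e := stdOrthonormalBasis 𝕜 R
  have hpe : ∀ u ∈ R, p u = u := by
    rintro _ ⟨v, rfl⟩
    exact projection_projection hp _
  have hsupp : ∀ u ∈ R, ∀ k ∉ blockSet b p j, ⟪b k, u⟫_𝕜 = 0 := by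
    rintro _ ⟨v, rfl⟩ k hk
    change ⟪b k, p (blockProj b p j v)⟫_𝕜 = 0
    rw [blockProj_apply_eq_sum b p j h, map_sum, inner_sum]
    refine Finset.sum_eq_zero fun i hi => ?_
    rw [map_smul, inner_smul_right]
    have := entry_eq_zero_of_mem_blockSet (h.mem_toFinset.1 hi) hk
    rw [entry] at this
    rw [this, mul_zero]
  have hpars : ∀ m, ∑ i ∈ h.toFinset, ⟪b i, (e m : H)⟫_𝕜 * ⟪(e m : H), b i⟫_𝕜 = 1 := fun m => by
    have h1 := b.hasSum_inner_mul_inner (e m : H) (e m : H)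
    have h2 : ⟪(e m : H), (e m : H)⟫_𝕜 = 1 := by
      rw [inner_self_eq_norm_sq_to_K, Submodule.norm_coe, e.orthonormal.1 m]
      simp
    rw [h2] at h1
    refine HasSum.unique (hasSum_sum_of_ne_finset_zero fun k hk => ?_)
      (by simpa only [mul_comm] using h1)
    rw [hsupp _ (e m).2 k (by simpa using hk), zero_mul]
  have hent : ∀ i ∈ h.toFinset,
      entry b p i i = ∑ m, ⟪b i, (e m : H)⟫_𝕜 * ⟪(e m : H), b i⟫_𝕜 := fun i hi => by
    have hm : p (b i) ∈ R :=
      ⟨b i, congrArg p (blockProj_basis_of_mem b p j (h.mem_toFinset.1 hi))⟩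
    have h1 := congrArg (Subtype.val) (e.sum_repr' ⟨p (b i), hm⟩)
    simp only [Submodule.coe_inner, AddSubmonoidClass.coe_finsetSum, Submodule.coe_smul] at h1
    rw [entry, ← h1, inner_sum]
    refine Finset.sum_congr rfl fun m _ => ?_
    rw [inner_smul_right, ← inner_projection_left hp, hpe _ (e m).2, mul_comm]
  rw [Finset.sum_congr rfl hent, Finset.sum_comm, Finset.sum_congr rfl fun m _ => hpars m]
  simp

/-- Equal ranges mean p q = q and q p = p. -/
theorem eq_add_of_range_eq {q : H →L[𝕜] H} (hq : q ∘L q = q) (hr : q.range = p.range) (v : H) :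
    q v = p v + p (q (v - p v)) := by
  have h1 : ∀ u, p (q u) = q u := fun u => by
    obtain ⟨w, hw⟩ : q u ∈ p.range := hr ▸ ⟨u, rfl⟩
    rw [← show p w = q u from hw, projection_projection hp]
  have h2 : q (p v) = p v := by
    obtain ⟨w, hw⟩ : p v ∈ q.range := hr ▸ ⟨v, rfl⟩
    rw [← show q w = p v from hw]
    exact congr($hq w)
  rw [h1, map_sub, h2]
  abel

theorem sum_entry_eq_of_range_eq {q : H →L[𝕜] H} (hq : q ∘L q = q) (hr : q.range = p.range)
    (j : BlockIndex b p) (h : (blockSet b p j).Finite) :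
    ∑ i ∈ h.toFinset, entry b q i i = ∑ i ∈ h.toFinset, entry b p i i := by
  have h1 : ∀ i ∈ h.toFinset, entry b q i i = entry b p i i +
      ∑ k ∈ h.toFinset, ⟪b k, q (entry b p i k • (b i - p (b i)))⟫_𝕜 := fun i hi => by
    rw [entry, eq_add_of_range_eq hp hq hr, inner_add_right,
      ← inner_projection_left hp _ (q _)]
    refine congrArg (entry b p i i + ·) ?_
    generalize b i - p (b i) = u
    rw [apply_basis_eq_sum b p j h (h.mem_toFinset.1 hi), sum_inner]
    refine Finset.sum_congr rfl fun k _ => ?_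
    rw [inner_smul_left, ← entry_projection_swap b hp, map_smul, inner_smul_right]
  rw [Finset.sum_congr rfl h1, Finset.sum_add_distrib, Finset.sum_comm, add_eq_left]
  refine Finset.sum_eq_zero fun k hk => ?_
  rw [← inner_sum, ← map_sum]
  -- This is (1 - p) p b_k, since p b_k is supported on the finite block of k.
  have h2 : ∑ i ∈ h.toFinset, entry b p i k • (b i - p (b i)) = 0 := by
    simp only [smul_sub, Finset.sum_sub_distrib, ← map_smul, ← map_sum]
    rw [← apply_basis_eq_sum b p j h (h.mem_toFinset.1 hk), projection_projection hp,
      sub_self]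
  rw [h2, map_zero, inner_zero_right]

theorem hasSum_norm_entry_sq (i : ι) :
    HasSum (fun k => ‖entry b p k i‖ ^ 2) (RCLike.re (entry b p i i)) := by
  have h1 := (b.hasSum_inner_mul_inner (p (b i)) (p (b i))).mapL RCLike.reCLM
  have h2 : ⟪p (b i), p (b i)⟫_𝕜 = entry b p i i := by
    rw [inner_projection_left hp, projection_projection hp, entry]
  rw [h2] at h1
  refine (funext fun k => ?_ : (fun k => ‖entry b p k i‖ ^ 2) = _) ▸ h1
  rw [RCLike.reCLM_apply, ← inner_conj_symm, RCLike.conj_mul, entry, ← RCLike.ofReal_pow,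
    RCLike.ofReal_re]

theorem ofReal_re_entry (i : ι) : ((RCLike.re (entry b p i i) : ℝ) : 𝕜) = entry b p i i :=
  RCLike.conj_eq_iff_re.1 (entry_projection_swap b hp i i).symm

end Projection

/-! ### Annihilators of the diagonals of p x (1 - p) -/

theorem summable_entry_mul (b : HilbertBasis ι 𝕜 H) (x : H →L[𝕜] H) {a : ι → 𝕜}
    (ha : Summable fun i => ‖a i‖) : Summable fun i => entry b x i i * a i :=
  .of_norm_bounded (ha.mul_left ‖x‖) fun i => by
    rw [norm_mul]
    exact mul_le_mul_of_nonneg_right (norm_entry_le b x i i) (norm_nonneg _)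

theorem entry_add (b : HilbertBasis ι 𝕜 H) (x y : H →L[𝕜] H) (i j : ι) :
    entry b (x + y) i j = entry b x i j + entry b y i j := inner_add_right _ _ _

theorem entry_sub (b : HilbertBasis ι 𝕜 H) (x y : H →L[𝕜] H) (i j : ι) :
    entry b (x - y) i j = entry b x i j - entry b y i j := inner_sub_right _ _ _

theorem entry_smul (b : HilbertBasis ι 𝕜 H) (r : 𝕜) (x : H →L[𝕜] H) (i j : ι) :
    entry b (r • x) i j = r * entry b x i j := inner_smul_right _ _ _

/-- The pairing of the diagonal of an operator with a summable sequence, as a linear map. -/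
noncomputable def diagPairing (b : HilbertBasis ι 𝕜 H) (a : ι → 𝕜)
    (ha : Summable fun i => ‖a i‖) : (H →L[𝕜] H) →ₗ[𝕜] 𝕜 where
  toFun x := ∑' i, entry b x i i * a i
  map_add' x y := by
    simp only [entry_add, add_mul]
    exact (summable_entry_mul b x ha).tsum_add (summable_entry_mul b y ha)
  map_smul' r x := by
    simp only [entry_smul, mul_assoc, RingHom.id_apply, smul_eq_mul]
    exact tsum_mul_left

theorem diagPairing_apply (b : HilbertBasis ι 𝕜 H) (a : ι → 𝕜)
    (ha : Summable fun i => ‖a i‖) (x : H →L[𝕜] H) :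
    diagPairing b a ha x = ∑' i, entry b x i i * a i := rfl

theorem trace_diagExp_comp (b : HilbertBasis ι 𝕜 H) (x : H →L[𝕜] H) {c : H →L[𝕜] H}
    (hc : IsTraceClass c) :
    trace b (diagExp b x ∘L c) =
      diagPairing b (fun i => entry b c i i) (hc.summable_norm_entry b) x :=
  tsum_congr fun i => entry_diagExp_comp b x c i

/-- A vector outside the range of T is separated from it by a linear functional; this
finite-dimensional duality replaces Hahn–Banach. -/
theorem exists_eq_of_forall_annihilator {α E : Type*} [Fintype α] [AddCommGroup E] [Module 𝕜 E]
    (T : E →ₗ[𝕜] α → 𝕜) (v : α → 𝕜)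
    (h : ∀ l : α → 𝕜, (∀ x, ∑ k, l k * T x k = 0) → ∑ k, l k * v k = 0) : ∃ x, T x = v := by
  classical
  by_contra hv
  obtain ⟨f, hfv, hf⟩ := Submodule.exists_le_ker_of_notMem (p := T.range) (v := v) hv
  have hsum : ∀ w, f w = ∑ k, f (fun j => if k = j then 1 else 0) * w k := fun w => by
    rw [f.pi_apply_eq_sum_univ w]
    simp only [smul_eq_mul, mul_comm]
  refine hfv ((hsum v).trans (h _ fun x => ?_))
  rw [← hsum]
  exact hf ⟨x, rfl⟩

theorem eq_of_blockSetoid {b : HilbertBasis ι 𝕜 H} {p : H →L[𝕜] H} {α : Type*} {a : ι → α}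
    (h : ∀ i k, entry b p i k ≠ 0 → a i = a k) {i k : ι} (hik : blockSetoid b p i k) :
    a i = a k := by
  change Relation.EqvGen _ i k at hik
  induction hik with
  | rel i k hik => exact h i k hik
  | refl => rfl
  | symm _ _ _ ih => exact ih.symm
  | trans _ _ _ _ _ ih1 ih2 => exact ih1.trans ih2

section
variable [CompleteSpace H] (b : HilbertBasis ι 𝕜 H) {p : H →L[𝕜] H} (hp : IsStarProjection p)
include hp

theorem eq_of_entry_ne_zero {a : ι → 𝕜} (ha : Summable fun i => ‖a i‖)
    (h : ∀ x : H →L[𝕜] H, diagPairing b a ha (p ∘L x ∘L (1 - p)) = 0) (i k : ι)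
    (hik : entry b p i k ≠ 0) : a i = a k := by
  classical
  refine eq_of_harmonic (w := fun i k => ‖entry b p k i‖ ^ 2)
    (s := fun i => RCLike.re (entry b p i i)) (fun _ _ => sq_nonneg _) (fun i k => ?_)
    (hasSum_norm_entry_sq b hp) (fun i => ?_) ha (fun i => ?_) i k ?_
  · rw [entry_projection_swap b hp, RCLike.norm_conj]
  -- The diagonal term of the row sum gives p_ii² ≤ p_ii, hence p_ii ≤ 1.
  · have h1 := le_hasSum (hasSum_norm_entry_sq b hp i) i fun _ _ => sq_nonneg _
    rw [← ofReal_re_entry b hp i, RCLike.norm_ofReal, RCLike.ofReal_re, sq_abs] at h1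
    nlinarith
  · have h1 := h (InnerProductSpace.rankOne 𝕜 (b i) (b i))
    have h2 := (summable_entry_mul b (p ∘L InnerProductSpace.rankOne 𝕜 (b i) (b i) ∘L (1 - p))
      ha).hasSum
    rw [← diagPairing_apply b a ha, h1] at h2
    -- The tested operator has diagonal entries (δ_ik - p_ik) p_ki; removing the δ part leaves the
    -- harmonic sum.
    have h3 := (hasSum_ite_eq i (entry b p i i * a i)).sub h2
    rw [sub_zero] at h3
    rw [ofReal_re_entry b hp i]
    refine (funext fun k => ?_ : (fun k => ((‖entry b p k i‖ ^ 2 : ℝ) : 𝕜) * a k) = _) ▸ h3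
    have h4 : entry b (p ∘L InnerProductSpace.rankOne 𝕜 (b i) (b i) ∘L (1 - p)) k k =
        ((if i = k then 1 else 0) - entry b p i k) * entry b p k i := by
      by_cases hik : i = k <;>
        simp [entry, inner_sub_right, inner_smul_right, orthonormal_iff_ite.1 b.orthonormal,
          b.orthonormal.1 k, hik, sub_mul]
    have h5 : ((‖entry b p k i‖ ^ 2 : ℝ) : 𝕜) = entry b p i k * entry b p k i := by
      rw [entry_projection_swap b hp i k, RCLike.conj_mul, RCLike.ofReal_pow]
    rw [h4, h5]
    by_cases hki : k = i
    · subst hki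
      simp
      ring
    · rw [if_neg hki, if_neg (Ne.symm hki)]
      ring
  · rw [entry_projection_swap b hp, RCLike.norm_conj]
    simpa using hik

theorem diagPairing_eq_zero_of_annihilator {a : ι → 𝕜} (ha : Summable fun i => ‖a i‖)
    (h : ∀ x : H →L[𝕜] H, diagPairing b a ha (p ∘L x ∘L (1 - p)) = 0) {y : H →L[𝕜] H}
    (hy : ∀ (j : BlockIndex b p) (hj : (blockSet b p j).Finite),
      ∑ i ∈ hj.toFinset, entry b y i i = 0) : diagPairing b a ha y = 0 := by
  have hconst : ∀ {i k : ι}, blockSetoid b p i k → a i = a k :=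
    eq_of_blockSetoid (eq_of_entry_ne_zero b hp ha h)
  have hfib := (summable_entry_mul b y ha).hasSum.tsum_fiberwise
    (Quotient.mk (blockSetoid b p))
  refine hfib.unique ?_
  convert hasSum_zero using 2 with j
  obtain ⟨i₀, rfl⟩ := Quotient.exists_rep j
  have hcl : ∀ i ∈ blockSet b p (Quotient.mk (blockSetoid b p) i₀), a i = a i₀ :=
    fun i hi => hconst (Quotient.exact hi)
  by_cases hj : (blockSet b p (Quotient.mk (blockSetoid b p) i₀)).Finite
  · have h1 := Finset.tsum_subtype' hj.toFinset fun i => entry b y i i * a i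
    rw [hj.coe_toFinset] at h1
    refine h1.trans ?_
    rw [Finset.sum_congr rfl fun i hi => by rw [hcl i (hj.mem_toFinset.1 hi)], ← Finset.sum_mul,
      hy _ hj, zero_mul]
  -- A nonzero constant on an infinite block would contradict a → 0 along the cofinite filter.
  · have h0 : a i₀ = 0 := by
      by_contra h0
      refine hj ?_
      have h1 := ha.tendsto_cofinite_zero.eventually (gt_mem_nhds (norm_pos_iff.2 h0))
      refine (Filter.eventually_cofinite.1 h1).subset fun i hi => ?_
      simp [hcl i hi]
    refine (tsum_congr fun i => ?_).trans tsum_zero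
    rw [hcl i i.2, h0, mul_zero]

theorem isIdempotent_add (x : H →L[𝕜] H) :
    (p + p ∘L x ∘L (1 - p)) ∘L (p + p ∘L x ∘L (1 - p)) = p + p ∘L x ∘L (1 - p) := by
  ext v
  simp [projection_projection hp]

theorem range_add (x : H →L[𝕜] H) : (p + p ∘L x ∘L (1 - p)).range = p.range := by
  apply le_antisymm
  · rintro _ ⟨v, rfl⟩
    exact ⟨v + x (v - p v), by simp⟩
  · rintro _ ⟨v, rfl⟩
    exact ⟨p v, by simp [projection_projection hp]⟩

end

/-! ### Closures in the w*-topology -/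

theorem continuous_trace_comp (b : HilbertBasis ι 𝕜 H) {c : H →L[𝕜] H} (hc : IsTraceClass c) :
    Continuous[weakStarTopology b, inferInstance] fun t : H →L[𝕜] H => trace b (t ∘L c) :=
  continuous_iInf_dom (i := ⟨c, hc⟩) continuous_induced_dom

theorem mem_closure_weakStarTopology (b : HilbertBasis ι 𝕜 H) {s : Set (H →L[𝕜] H)}
    {d : H →L[𝕜] H} (h : ∀ I : Finset {c : H →L[𝕜] H // IsTraceClass c},
      ∃ t ∈ s, ∀ c ∈ I, trace b (t ∘L c.1) = trace b (d ∘L c.1)) :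
    d ∈ closure[weakStarTopology b] s := by
  rw [weakStarTopology, ← induced_to_pi fun (t : H →L[𝕜] H)
    (c : {c : H →L[𝕜] H // IsTraceClass c}) => trace b (t ∘L c.1), closure_induced,
    mem_closure_iff]
  intro o ho hd
  obtain ⟨I, u, hu, hIo⟩ := isOpen_pi_iff.1 ho _ hd
  obtain ⟨t, hts, ht⟩ := h I
  exact ⟨_, hIo fun c hc => (ht c hc ▸ (hu c hc).2 : trace b (t ∘L c.1) ∈ u c), t, hts, rfl⟩

/-- Makes matrix entries w*-continuous, so that diagonality is a closed condition. -/
theorem trace_comp_rankOne (b : HilbertBasis ι 𝕜 H) (t : H →L[𝕜] H) (i j : ι) :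
    trace b (t ∘L InnerProductSpace.rankOne 𝕜 (b j) (b i)) = entry b t i j := by
  classical
  rw [trace, tsum_eq_single i fun k hk => ?_]
  · simp [entry, b.orthonormal.1 i]
  · simp [entry, orthonormal_iff_ite.1 b.orthonormal, hk.symm]

theorem isClosed_setOf_trace_eq [CompleteSpace H] (b : HilbertBasis ι 𝕜 H) (p : H →L[𝕜] H)
    (r : BlockIndex b p → 𝕜) :
    IsClosed[weakStarTopology b] {d : H →L[𝕜] H | IsDiagonal b d ∧
      ∀ j : BlockIndex b p, FiniteDimensional 𝕜 (blockProj b p j).range →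
        trace b (d ∘L blockProj b p j) = r j} := by
  let _ : TopologicalSpace (H →L[𝕜] H) := weakStarTopology b
  have h1 : IsClosed {d : H →L[𝕜] H | ∀ i j, i ≠ j → entry b d i j = 0} := by
    simp only [Set.ofPred_forall]
    refine isClosed_iInter fun i => isClosed_iInter fun j => isClosed_iInter fun _ => ?_
    simp only [← trace_comp_rankOne b]
    exact isClosed_eq (continuous_trace_comp b (isTraceClass_rankOne _ _)) continuous_const
  refine h1.inter (s₂ := {d | ∀ j : BlockIndex b p, FiniteDimensional 𝕜 (blockProj b p j).range →
    trace b (d ∘L blockProj b p j) = r j}) ?_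
  simp only [Set.ofPred_forall]
  refine isClosed_iInter fun j => isClosed_iInter fun hj => ?_
  exact isClosed_eq (continuous_trace_comp b (isTraceClass_blockProj b p j
    (finite_blockSet b p j))) continuous_const

end DiagIdem

theorem mainTheorem10 {𝕜 : Type*} [RCLike 𝕜] {H : Type*} [NormedAddCommGroup H]
    [InnerProductSpace 𝕜 H] [CompleteSpace H] [TopologicalSpace.SeparableSpace H]
    {ι : Type*} (b : HilbertBasis ι 𝕜 H) (p : H →L[𝕜] H) (hp : IsStarProjection p) :
    closure[DiagIdem.weakStarTopology b]
        {t : H →L[𝕜] H | ∃ q : H →L[𝕜] H, q ∘L q = q ∧ q.range = p.range ∧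
          t = DiagIdem.diagExp b q} =
      {d : H →L[𝕜] H | DiagIdem.IsDiagonal b d ∧
        ∀ j : DiagIdem.BlockIndex b p,
          FiniteDimensional 𝕜 (DiagIdem.blockProj b p j).range →
            DiagIdem.trace b (d ∘L DiagIdem.blockProj b p j) =
              (Module.finrank 𝕜 (p ∘L DiagIdem.blockProj b p j).range : 𝕜)} := by
  classical
  have hentry : ∀ (x : H →L[𝕜] H) i,
      DiagIdem.entry b (DiagIdem.diagExp b x) i i = DiagIdem.entry b x i i := fun x i => by
    rw [DiagIdem.entry_diagExp, if_pos rfl]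
  apply Set.Subset.antisymm
  · refine (@IsClosed.closure_subset_iff _ (DiagIdem.weakStarTopology b) _ _
      (DiagIdem.isClosed_setOf_trace_eq b p _)).2 ?_
    rintro _ ⟨q, hq, hr, rfl⟩
    refine ⟨DiagIdem.isDiagonal_diagExp b q, fun j hj => ?_⟩
    have hf := DiagIdem.finite_blockSet b p j
    rw [DiagIdem.trace_comp_blockProj b p j hf, ← DiagIdem.sum_entry_eq_finrank b hp j hf,
      ← DiagIdem.sum_entry_eq_of_range_eq b hp hq hr j hf]
    exact Finset.sum_congr rfl fun i _ => hentry q i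
  · rintro d ⟨hd, hdj⟩
    refine DiagIdem.mem_closure_weakStarTopology b fun I => ?_
    let a : I → ι → 𝕜 := fun c i => DiagIdem.entry b c.1.1 i i
    have ha : ∀ c, Summable fun i => ‖a c i‖ := fun c => c.1.2.summable_norm_entry b
    let T : (H →L[𝕜] H) →ₗ[𝕜] I → 𝕜 :=
      LinearMap.pi fun c => DiagIdem.diagPairing b (a c) (ha c)
    let S : (H →L[𝕜] H) →ₗ[𝕜] (H →L[𝕜] H) :=
      { toFun := fun x => p ∘L x ∘L (1 - p)
        map_add' := fun x y => by ext v; simp [add_sub_add_comm]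
        map_smul' := fun r x => by ext v; simp [smul_sub] }
    -- Against finitely many test operators the pairings are matched exactly: a relation l among the
    -- values of T ∘ S merges the test diagonals into one annihilating sequence.
    obtain ⟨x, hx⟩ : ∃ x, (T ∘ₗ S) x = T (d - p) := by
      refine DiagIdem.exists_eq_of_forall_annihilator _ _ fun l hl => ?_
      have hL : Summable fun i => ‖∑ c, l c * a c i‖ := by
        refine (summable_sum (s := Finset.univ) fun c _ =>
          (ha c).mul_left ‖l c‖).of_nonneg_of_le (fun _ => norm_nonneg _) fun i => ?_
        simpa only [norm_mul] using norm_sum_le Finset.univ fun c => l c * a c i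
      have hLT : ∀ y, ∑ c, l c * T y c = DiagIdem.diagPairing b _ hL y := fun y => by
        simp only [T, LinearMap.pi_apply, DiagIdem.diagPairing_apply, Finset.mul_sum,
          ← tsum_mul_left]
        rw [← Summable.tsum_finsetSum fun c _ =>
          (DiagIdem.summable_entry_mul b y (ha c)).mul_left (l c)]
        exact tsum_congr fun i => Finset.sum_congr rfl fun c _ => mul_left_comm _ _ _
      rw [hLT]
      refine DiagIdem.diagPairing_eq_zero_of_annihilator b hp hL
        (fun x => (hLT _).symm.trans (hl x)) fun j hj => ?_
      have := DiagIdem.finiteDimensional_range_blockProj b p j hj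
      simp only [DiagIdem.entry_sub, Finset.sum_sub_distrib]
      rw [DiagIdem.sum_entry_eq_finrank b hp j hj, ← DiagIdem.trace_comp_blockProj b p j hj,
        hdj j this, sub_self]
    refine ⟨_, ⟨p + S x, DiagIdem.isIdempotent_add hp x, DiagIdem.range_add hp x, rfl⟩,
      fun c hc => ?_⟩
    have hxc : T (S x) ⟨c, hc⟩ = T (d - p) ⟨c, hc⟩ := congrFun hx _
    rw [← hd.diagExp_eq, DiagIdem.trace_diagExp_comp b _ c.2, DiagIdem.trace_diagExp_comp b _ c.2]
    change T (p + S x) ⟨c, hc⟩ = T d ⟨c, hc⟩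
    rw [map_add, Pi.add_apply, hxc, map_sub, Pi.sub_apply, add_sub_cancel]
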